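/- Let $G=(V,E)$ be a finite simple graph with $e(G)$ edges and let $x\in[0,1)$. Let $\mathcal{A}(G,x)$ be the set of real symmetric positive definite $V\times V$ matrices $M$ such that $M_{i,i}=1$ for every $i\in V$ and $M_{i,j}=x$ for every edge $(i,j)$ of $G$. Then $\det$ attains a maximum on $\mathcal{A}(G,x)$, and its maximum value $$\tau(G,x):=\max_{M\in\mathcal{A}(G,x)}\det M$$ satisfies $$\tau(G,x)\ge (1-x^2)^{e(G)}.$$ -/

import Mathlib

/-- The set `𝒜(G, x)` of real positive definite `V × V` matrices with all diagonal entries `1`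
and with the entry `x` at every pair of adjacent vertices of `G`. -/
def admissible {V : Type*} (G : SimpleGraph V) (x : ℝ) : Set (Matrix V V ℝ) :=
  {M | M.PosDef ∧ (∀ i, M i i = 1) ∧ ∀ i j, G.Adj i j → M i j = x}

/-- The largest determinant of a matrix in `𝒜(G, x)`, as the supremum of the set of determinants;
the theorem also asserts that this supremum is attained. -/
noncomputable def tau {V : Type*} [Fintype V] [DecidableEq V] (G : SimpleGraph V) (x : ℝ) : ℝ :=
  sSup (Matrix.det '' admissible G x)

open Matrix

/-! ### Determinant inequalities and perturbations at two indices. -/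

namespace Matrix

variable {ι : Type*} [Fintype ι] [DecidableEq ι]

/-! Induct on the number of edges, also requiring all off-diagonal entries to be at most `x`. Let
`M` maximize the determinant under these constraints and let `K` be its inverse. First-order
optimality (`exists_tightPair`) gives `K i j ≥ 0` at non-edges, and `M i j = x` wherever an
off-diagonal `K i j` is positive.

Some non-isolated `v` has positive row sum in `K`; that row is then nonpositive off the diagonal
(`right_apply_nonpos`). With the triangle inequality `mul_apply_le`, an edge `vu` satisfies `J * (1
- x ^ 2) ≤ x` for `J = -K v u`.

Delete `vu` and let `N` be the matrix given by induction. Cancel the `vu` entries of `K` and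
subtract `J * x` at the two diagonal places, giving `L`. Then `L` is positive semidefinite and `tr
(L N) ≤ tr (L M) = |V|`, so AM–GM gives `det L * det N ≤ 1`. As `det L = det K * (1 - (J * (1 - x ^
2)) ^ 2)`, the deleted edge costs a factor of at least `1 - x ^ 2`. -/

theorem PosSemidef.det_le_one_of_trace_le {S : Matrix ι ι ℝ} (hS : S.PosSemidef)
    (h : S.trace ≤ Fintype.card ι) : S.det ≤ 1 := by
  rw [hS.isHermitian.trace_eq_sum_eigenvalues] at h
  rw [hS.isHermitian.det_eq_prod_eigenvalues]
  simp only [RCLike.ofReal_real_eq_id, id] at h ⊢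
  calc ∏ i, hS.isHermitian.eigenvalues i
      ≤ ∏ i, Real.exp (hS.isHermitian.eigenvalues i - 1) := by
        refine Finset.prod_le_prod (fun i _ => hS.eigenvalues_nonneg i) fun i _ => ?_
        linarith [Real.add_one_le_exp (hS.isHermitian.eigenvalues i - 1)]
    _ = Real.exp (∑ i, (hS.isHermitian.eigenvalues i - 1)) := (Real.exp_sum _ _).symm
    _ ≤ 1 := by
        rw [Real.exp_le_one_iff, Finset.sum_sub_distrib]
        simpa using h

open scoped MatrixOrder in
/-- The AM–GM inequality for the eigenvalues of a product of positive semidefinite matrices. -/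
theorem PosSemidef.det_mul_det_le_one {A B : Matrix ι ι ℝ} (hA : A.PosSemidef)
    (hB : B.PosSemidef) (h : (A * B).trace ≤ Fintype.card ι) : A.det * B.det ≤ 1 := by
  obtain ⟨L, rfl⟩ := CStarAlgebra.nonneg_iff_eq_star_mul_self.mp hB.nonneg
  have := (hA.mul_mul_conjTranspose_same L).det_le_one_of_trace_le (by
    rwa [star_eq_conjTranspose, ← Matrix.mul_assoc, trace_mul_comm, ← Matrix.mul_assoc] at h)
  simp only [det_mul, star_eq_conjTranspose] at this ⊢
  linarith

omit [DecidableEq ι] in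
theorem PosSemidef.sq_dotProduct_mulVec_le {M : Matrix ι ι ℝ} (hM : M.PosSemidef) (f g : ι → ℝ) :
    (f ⬝ᵥ M *ᵥ g) ^ 2 ≤ (f ⬝ᵥ M *ᵥ f) * (g ⬝ᵥ M *ᵥ g) := by
  have hs : g ⬝ᵥ M *ᵥ f = f ⬝ᵥ M *ᵥ g := by
    have : Mᵀ = M := hM.isHermitian
    rw [dotProduct_mulVec, ← mulVec_transpose, this, dotProduct_comm]
  have key (t : ℝ) : 0 ≤ (g ⬝ᵥ M *ᵥ g) * (t * t) + (2 * (f ⬝ᵥ M *ᵥ g)) * t + f ⬝ᵥ M *ᵥ f := by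
    have := hM.dotProduct_mulVec_nonneg (f + t • g)
    simp only [star_trivial, mulVec_add, mulVec_smul, dotProduct_add, add_dotProduct,
      smul_dotProduct, dotProduct_smul, smul_eq_mul, hs] at this
    linarith
  have := discrim_le_zero key
  rw [discrim] at this
  linarith

/-- A perturbation supported on the rows and columns `p 0`, `p 1`. -/
theorem det_add_submatrix {A B S : Matrix ι ι ℝ} (hAB : A * B = 1) (p : Fin 2 → ι)
    (T : Matrix (Fin 2) (Fin 2) ℝ)
    (hS : S = (1 : Matrix ι ι ℝ).submatrix id p * T * (1 : Matrix ι ι ℝ).submatrix p id) :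
    (A + S).det = A.det * (1 + T * B.submatrix p p).det := by
  have h : A + S = A * (1 + (B * (1 : Matrix ι ι ℝ).submatrix id p) *
      (T * (1 : Matrix ι ι ℝ).submatrix p id)) := by
    rw [Matrix.mul_add, Matrix.mul_one, hS]
    simp only [← Matrix.mul_assoc, hAB, Matrix.one_mul]
  rw [h, det_mul, det_one_add_mul_comm]
  congr 3
  rw [Matrix.mul_assoc]
  congr 1
  ext k l
  simp [Matrix.mul_apply, Matrix.one_apply]

theorem det_add_pair {A B : Matrix ι ι ℝ} (hAB : A * B = 1) (i j : ι) (a b c d : ℝ) :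
    (A + (single i i a + single i j b + (single j i c + single j j d))).det =
      A.det * ((1 + (a * B i i + b * B j i)) * (1 + (c * B i j + d * B j j)) -
        (a * B i j + b * B j j) * (c * B i i + d * B j i)) := by
  rw [det_add_submatrix hAB ![i, j] !![a, b; c, d]]
  · congr 1
    simp only [det_fin_two, Matrix.mul_apply, Fin.sum_univ_two, submatrix_apply, add_apply]
    simp
  · ext k l
    simp only [Matrix.mul_apply, Fin.sum_univ_two, submatrix_apply, one_apply, single_apply,
      add_apply]
    simp
    grind

end Matrix

/-! ### Tight pairs: signs of the inverse and the triangle inequality. -/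

/-- The conditions on a correlation matrix `M` with inverse `K` that hold when `M` maximizes the
determinant among the matrices whose off-diagonal entries are at most `x`, some of them being
prescribed to equal `x`. -/
structure TightPair {ι : Type*} [Fintype ι] [DecidableEq ι] (x : ℝ) (M K : Matrix ι ι ℝ) :
    Prop where
  posDef : M.PosDef
  diag : ∀ i, M i i = 1
  le : ∀ i j, i ≠ j → M i j ≤ x
  mul_eq_one : M * K = 1
  tight : ∀ i j, i ≠ j → 0 < K i j → M i j = x

namespace TightPair

variable {ι : Type*} [Fintype ι] [DecidableEq ι] {x : ℝ} {M K : Matrix ι ι ℝ}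

theorem mul_eq_one' (h : TightPair x M K) : K * M = 1 :=
  mul_eq_one_comm.mp h.mul_eq_one

theorem eq_inv (h : TightPair x M K) : K = M⁻¹ :=
  (inv_eq_right_inv h.mul_eq_one).symm

theorem posDef_right (h : TightPair x M K) : K.PosDef :=
  h.eq_inv ▸ h.posDef.inv

theorem symm_left (h : TightPair x M K) (i j : ι) : M i j = M j i := by
  simpa using h.posDef.isHermitian.apply j i

theorem symm_right (h : TightPair x M K) (i j : ι) : K i j = K j i := by
  simpa using h.posDef_right.isHermitian.apply j i

theorem sum_mul (h : TightPair x M K) {v w : ι} (hvw : v ≠ w) :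
    ∑ a ∈ Finset.univ.erase v, (-K v a) * M a w = K v v * M v w := by
  have h1 := congrFun (congrFun h.mul_eq_one' v) w
  rw [mul_apply, one_apply_ne hvw, ← Finset.add_sum_erase _ _ (Finset.mem_univ v)] at h1
  simp only [neg_mul, Finset.sum_neg_distrib]
  linarith

/-- A row of the inverse with positive sum has no positive off-diagonal entry. -/
theorem right_apply_nonpos (h : TightPair x M K) (hx : 0 ≤ x) {v w : ι}
    (hv : 0 < ∑ w, K v w) (hvw : v ≠ w) : K v w ≤ 0 := by
  by_contra! hpos
  have hκ : 0 < K v v := h.posDef_right.diag_pos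
  -- `f` and `g` are the negative and positive parts of row `v` off the diagonal; tightness makes `M
  -- v a = x` on the support of `g`.
  set f : ι → ℝ := fun a => if a = v then 0 else max (-K v a) 0 with hf
  set g : ι → ℝ := fun a => if a = v then 0 else max (K v a) 0 with hg
  have hfv : f v = 0 := by simp [hf]
  have hgv : g v = 0 := by simp [hg]
  have hf0 (a : ι) : 0 ≤ f a := by simp only [hf]; split_ifs <;> simp
  have hg0 (a : ι) : 0 ≤ g a := by simp only [hg]; split_ifs <;> simp
  have hfg (a : ι) (ha : a ≠ v) : f a - g a = -K v a := by
    simp only [hf, hg, ha, if_false]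
    rcases le_total 0 (K v a) with hk | hk
    · rw [max_eq_right (by linarith), max_eq_left hk]; ring
    · rw [max_eq_left (by linarith), max_eq_right hk]; ring
  have hdisj (a : ι) : f a = 0 ∨ g a = 0 := by
    simp only [hf, hg]
    rcases le_total 0 (K v a) with hk | hk
    · left; split_ifs <;> simp [hk]
    · right; split_ifs <;> simp [hk]
  have hMc (a : ι) (ha : a ≠ v) : (M *ᵥ f) a - (M *ᵥ g) a = K v v * M v a := by
    rw [← h.sum_mul ha.symm, ← Pi.sub_apply, ← mulVec_sub, mulVec, dotProduct,
      ← Finset.add_sum_erase _ _ (Finset.mem_univ v)]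
    simp only [Pi.sub_apply, hfv, hgv, sub_self, mul_zero, zero_add]
    refine Finset.sum_congr rfl fun b hb => ?_
    rw [hfg b (Finset.ne_of_mem_erase hb), h.symm_left a b, mul_comm]
  have hdot (p : ι → ℝ) (hp : p v = 0) :
      p ⬝ᵥ M *ᵥ f - p ⬝ᵥ M *ᵥ g = K v v * ∑ a, p a * M v a := by
    rw [← dotProduct_sub, dotProduct, Finset.mul_sum]
    refine Finset.sum_congr rfl fun a _ => ?_
    rcases eq_or_ne a v with rfl | ha
    · simp [hp]
    · rw [Pi.sub_apply, hMc a ha]; ring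
  have hα : ∑ a, f a * M v a ≤ (∑ a, f a) * x := by
    rw [Finset.sum_mul]
    refine Finset.sum_le_sum fun a _ => ?_
    rcases eq_or_ne a v with rfl | ha
    · simp [hfv]
    · exact mul_le_mul_of_nonneg_left (h.le _ _ ha.symm) (hf0 a)
  have hβ : ∑ a, g a * M v a = (∑ a, g a) * x := by
    rw [Finset.sum_mul]
    refine Finset.sum_congr rfl fun a _ => ?_
    rcases eq_or_ne a v with rfl | ha
    · simp [hgv]
    · by_cases hk : 0 < K v a
      · rw [h.tight _ _ ha.symm hk]
      · simp [hg, ha, max_eq_right (not_lt.mp hk)]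
  have hP : f ⬝ᵥ M *ᵥ g ≤ x * (∑ a, f a) * ∑ a, g a := by
    rw [mul_assoc, Finset.sum_mul_sum, Finset.mul_sum, dotProduct]
    refine Finset.sum_le_sum fun a _ => ?_
    rw [mulVec, dotProduct, Finset.mul_sum, Finset.mul_sum]
    refine Finset.sum_le_sum fun b _ => ?_
    rcases eq_or_ne a b with rfl | hab
    · rcases hdisj a with h0 | h0 <;> simp [h0]
    · have := mul_le_mul_of_nonneg_right (h.le a b hab) (mul_nonneg (hf0 a) (hg0 b))
      linarith
  have hgf : g ⬝ᵥ M *ᵥ f = f ⬝ᵥ M *ᵥ g := by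
    have : Mᵀ = M := h.posDef.isHermitian
    rw [dotProduct_mulVec, ← mulVec_transpose, this, dotProduct_comm]
  have hgw : 0 < g w := by simp [hg, hvw.symm, hpos]
  have hG : 0 < g ⬝ᵥ M *ᵥ g := by
    have := h.posDef.dotProduct_mulVec_pos (x := g) (fun h0 => by simp [h0] at hgw)
    simpa using this
  have hC := h.posDef.posSemidef.sq_dotProduct_mulVec_le f g
  have e1 := hdot f hfv
  have e2 := hdot g hgv
  have hsum : ∑ a, K v a = K v v - ∑ a, f a + ∑ a, g a := by
    rw [← Finset.add_sum_erase _ _ (Finset.mem_univ v),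
      ← Finset.add_sum_erase _ f (Finset.mem_univ v),
      ← Finset.add_sum_erase _ g (Finset.mem_univ v), hfv, hgv, Finset.sum_congr rfl fun a ha =>
        neg_eq_iff_eq_neg.mp (hfg a (Finset.ne_of_mem_erase ha)).symm]
    simp only [Finset.sum_neg_distrib, Finset.sum_sub_distrib]
    ring
  have hs0 : 0 ≤ ∑ a, f a := Finset.sum_nonneg fun a _ => hf0 a
  have hσ0 : 0 ≤ ∑ a, g a := Finset.sum_nonneg fun a _ => hg0 a
  rw [hβ, hgf] at e2
  rw [hsum] at hv
  -- Cauchy–Schwarz `P ^ 2 ≤ R * Q`, with `R = P + κ * α` and `Q = P - κ * σ * x`, yields `σ * P ≤ s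
  -- * Q`. Combined with `P ≤ x * s * σ` this forces `κ ≤ s - σ`, against the positive row sum `κ -
  -- s + σ`.
  generalize f ⬝ᵥ M *ᵥ g = P at *
  generalize g ⬝ᵥ M *ᵥ g = Q at *
  generalize f ⬝ᵥ M *ᵥ f = R at *
  generalize ∑ a, f a * M v a = α at *
  generalize (∑ a, f a) = s at *
  generalize (∑ a, g a) = σ at *
  generalize K v v = κ at *
  have hxσ : 0 ≤ κ * (σ * x) := by positivity
  have hPpos : 0 < P := by linarith
  have hxpos : 0 < x := by
    refine hx.lt_of_ne fun h0 => ?_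
    rw [← h0] at hP
    linarith
  have h1 : κ * (σ * x) * P ≤ κ * α * Q := by
    have hR : R = P + κ * α := by linarith
    have hQ : Q = P - κ * (σ * x) := by linarith
    rw [hR] at hC
    nlinarith
  have h2 : κ * (σ * x) * P ≤ κ * (s * x) * Q :=
    h1.trans (mul_le_mul_of_nonneg_right (mul_le_mul_of_nonneg_left hα hκ.le) hG.le)
  have h3 : σ * P ≤ s * Q := by
    refine le_of_mul_le_mul_left ?_ (mul_pos hκ hxpos)
    linarith
  have h4 : κ * P ≤ P * (s - σ) := by
    have hQ : Q = P - κ * (σ * x) := by linarith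
    rw [hQ] at h3
    nlinarith
  nlinarith

end TightPair

namespace TightPair

/-- For `e = 1 - M v ·`, which is nonnegative and vanishes at `v`, the vector `K e` agrees with the
row sums of `K` away from `v`. Hence `eᵀ K e > 0` is a nonnegative combination of those sums. -/
theorem exists_sum_pos {ι : Type*} [Fintype ι] [DecidableEq ι] {x : ℝ} {M K : Matrix ι ι ℝ}
    (h : TightPair x M K) (hx1 : x < 1) {v w : ι} (hvw : v ≠ w) :
    ∃ z, z ≠ v ∧ 0 < ∑ a, K z a := by
  by_contra! hz
  set e : ι → ℝ := fun a => 1 - M v a with he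
  have hev : e v = 0 := by simp [he, h.diag]
  have he0 (a : ι) : 0 ≤ e a := by
    rcases eq_or_ne v a with rfl | ha
    · exact hev.ge
    · have := h.le v a ha
      simp only [he]; linarith
  have hpos : 0 < e ⬝ᵥ K *ᵥ e := by
    have hne : e ≠ 0 := fun h0 => by
      have h1 := congrFun h0 w
      have h2 := h.le v w hvw
      simp only [he, Pi.zero_apply] at h1
      linarith
    simpa using h.posDef_right.dotProduct_mulVec_pos hne
  refine hpos.not_ge (Finset.sum_nonpos fun a _ => ?_)
  rcases eq_or_ne a v with rfl | ha
  · simp [hev]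
  · have h1 : (K *ᵥ e) a = ∑ b, K a b := by
      have h2 := congrFun (congrFun h.mul_eq_one' a) v
      rw [mul_apply, one_apply_ne ha] at h2
      simp only [mulVec, dotProduct, he, mul_sub, mul_one, Finset.sum_sub_distrib]
      rw [sub_eq_self, ← h2]
      exact Finset.sum_congr rfl fun b _ => by rw [h.symm_left v b]
    rw [h1]
    exact mul_nonpos_of_nonneg_of_nonpos (he0 a) (hz a ha)

/-- Deleting an index whose row in the inverse is nonpositive off the diagonal. -/
theorem restrict {ι : Type*} [Fintype ι] [DecidableEq ι] {x : ℝ} {M K : Matrix ι ι ℝ}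
    (h : TightPair x M K) {z : ι} (hz : ∀ a, z ≠ a → K z a ≤ 0) :
    TightPair x (M.submatrix ((↑) : {a // a ≠ z} → ι) (↑))
      (of fun a b : {a // a ≠ z} => K a b - K a z * K z b / K z z) where
  posDef := h.posDef.submatrix Subtype.val_injective
  diag i := h.diag i
  le i j hij := h.le i j (Subtype.coe_injective.ne hij)
  mul_eq_one := by
    -- The inverse of a principal submatrix of `M` is a Schur complement in `K`.
    have hκ : K z z ≠ 0 := h.posDef_right.diag_pos.ne'
    have hsum (F : ι → ℝ) : ∑ b : {a // a ≠ z}, F b = ∑ b, F b - F z := by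
      rw [← Finset.add_sum_erase _ F (Finset.mem_univ z), add_sub_cancel_left]
      exact (Finset.sum_subtype _ (by simp) F).symm
    ext a c
    have h1 := congrFun (congrFun h.mul_eq_one a) c
    have h2 := congrFun (congrFun h.mul_eq_one a) z
    rw [mul_apply] at h1 h2
    rw [one_apply_ne a.2] at h2
    have h3 : (1 : Matrix {a // a ≠ z} {a // a ≠ z} ℝ) a c = (1 : Matrix ι ι ℝ) a c := by
      simp [one_apply, Subtype.ext_iff]
    rw [h3, ← h1, mul_apply]
    simp only [submatrix_apply, of_apply]
    rw [hsum fun b => M a b * (K b c - K b z * K z c / K z z)]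
    simp only [mul_sub, Finset.sum_sub_distrib]
    have h4 : ∑ b, M a b * (K b z * K z c / K z z) = 0 := by
      calc ∑ b, M a b * (K b z * K z c / K z z)
          = (∑ b, M a b * K b z) * (K z c / K z z) := by
            rw [Finset.sum_mul]; exact Finset.sum_congr rfl fun b _ => by ring
        _ = 0 := by rw [h2, zero_mul]
    rw [h4]
    field_simp
    ring
  tight i j hij hpos := by
    refine h.tight i j (Subtype.coe_injective.ne hij) (hpos.trans_le ?_)
    have h1 : 0 ≤ K i z * K z j := by
      rw [h.symm_right i z]
      exact mul_nonneg_of_nonpos_of_nonpos (hz _ i.2.symm) (hz _ j.2.symm)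
    have := div_nonneg h1 (h.posDef_right.diag_pos (i := z)).le
    simp only [of_apply]
    linarith

/-- Remove an index `z ≠ v` with positive row sum. Since `K M = 1`, row `z` of `M` is, off the
diagonal, a nonnegative combination of the other rows, so the inequality passes from them to row
`z`. -/
theorem mul_apply_le_of_card (n : ℕ) {ι : Type*} [Fintype ι] [DecidableEq ι] {x : ℝ}
    {M K : Matrix ι ι ℝ} (hn : Fintype.card ι = n) (h : TightPair x M K) (hx : 0 ≤ x)
    (hx1 : x < 1) (u v w : ι) : M u v * M v w ≤ M u w := by
  induction n generalizing ι with
  | zero => exact ((Fintype.card_eq_zero_iff.mp hn).false u).elim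
  | succ n ih =>
    rcases eq_or_ne u v with rfl | huv
    · rw [h.diag, one_mul]
    obtain ⟨z, hzv, hz⟩ := h.exists_sum_pos hx1 huv.symm
    have hrow (a : ι) (ha : z ≠ a) : K z a ≤ 0 := h.right_apply_nonpos hx hz ha
    have hcard : Fintype.card {a // a ≠ z} = n := by
      rw [Fintype.card_subtype_compl, hn, Fintype.card_subtype_eq, Nat.add_sub_cancel]
    have hne (a b : ι) (ha : a ≠ z) (hb : b ≠ z) : M a v * M v b ≤ M a b :=
      ih hcard (h.restrict hrow) ⟨a, ha⟩ ⟨v, hzv.symm⟩ ⟨b, hb⟩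
    have hkey (b : ι) (hb : b ≠ z) : M z v * M v b ≤ M z b := by
      have hκ : 0 < K z z := h.posDef_right.diag_pos
      have h1 : 0 ≤ ∑ a ∈ Finset.univ.erase z, (-K z a) * (M a b - M a v * M v b) := by
        refine Finset.sum_nonneg fun a ha => ?_
        have ha := Finset.ne_of_mem_erase ha
        exact mul_nonneg (neg_nonneg.mpr (hrow a ha.symm)) (sub_nonneg.mpr (hne a b ha hb))
      have h2 : ∑ a ∈ Finset.univ.erase z, (-K z a) * (M a b - M a v * M v b) =
          K z z * (M z b - M z v * M v b) := by
        simp only [mul_sub, ← mul_assoc, Finset.sum_sub_distrib, ← Finset.sum_mul]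
        rw [h.sum_mul hb.symm, h.sum_mul hzv]
      rw [h2] at h1
      exact sub_nonneg.mp (nonneg_of_mul_nonneg_right h1 hκ)
    rcases eq_or_ne u z with rfl | hu
    · rcases eq_or_ne w u with rfl | hw
      · rw [h.symm_left v w, h.diag, ← sq]
        have := h.posDef.posSemidef.sq_dotProduct_mulVec_le (Pi.single w 1) (Pi.single v 1)
        simpa [h.diag] using this
      · exact hkey w hw
    · rcases eq_or_ne w z with rfl | hw
      · have := hkey u hu
        rwa [h.symm_left w u, h.symm_left v u, h.symm_left w v, mul_comm] at this
      · exact hne u w hu hw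

/-- The entries of `M` satisfy the multiplicative triangle inequality. -/
theorem mul_apply_le {ι : Type*} [Fintype ι] [DecidableEq ι] {x : ℝ}
    {M K : Matrix ι ι ℝ} (h : TightPair x M K) (hx : 0 ≤ x)
    (hx1 : x < 1) (u v w : ι) : M u v * M v w ≤ M u w :=
  mul_apply_le_of_card _ rfl h hx hx1 u v w

end TightPair

/-! ### Existence of determinant maximizers and symmetric perturbations. -/

section

variable {V : Type*} [Fintype V] [DecidableEq V]

theorem Matrix.isCompact_setOf_posSemidef_diag_eq_one :
    IsCompact {M : Matrix V V ℝ | M.PosSemidef ∧ ∀ i, M i i = 1} := by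
  have hbox : IsCompact (X := Matrix V V ℝ)
      (Set.univ.pi fun _ : V => Set.univ.pi fun _ : V => Set.Icc (-1 : ℝ) 1) :=
    isCompact_univ_pi fun _ => isCompact_univ_pi fun _ => isCompact_Icc
  refine hbox.of_isClosed_subset ?_ ?_
  · have hent (i j : V) : Continuous fun M : Matrix V V ℝ => M i j :=
      continuous_id.matrix_elem i j
    simp only [posSemidef_iff_dotProduct_mulVec, Set.ofPred_and, Set.ofPred_forall]
    refine ((isClosed_eq continuous_id.matrix_conjTranspose continuous_id).inter
      (isClosed_iInter fun X => isClosed_le continuous_const ?_)).inter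
      (isClosed_iInter fun i => isClosed_eq (hent i i) continuous_const)
    exact continuous_const.dotProduct (continuous_id.matrix_mulVec continuous_const)
  · rintro M ⟨hM, hd⟩ i - j -
    have h := hM.sq_dotProduct_mulVec_le (Pi.single i 1) (Pi.single j 1)
    simp only [mulVec_single_one, single_one_dotProduct, col_apply, hd, mul_one] at h
    exact Set.mem_Icc.mpr (abs_le.mp ((sq_le_one_iff_abs_le_one _).mp h))

theorem exists_isMaxOn_det {S : Set (Matrix V V ℝ)} (hS : IsClosed S) {N : Matrix V V ℝ}
    (hN : N.PosDef) (hd : ∀ i, N i i = 1) (hNS : N ∈ S) :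
    ∃ M, M.PosDef ∧ (∀ i, M i i = 1) ∧ M ∈ S ∧
      ∀ A : Matrix V V ℝ, A.PosSemidef → (∀ i, A i i = 1) → A ∈ S → A.det ≤ M.det := by
  obtain ⟨M, ⟨⟨hM, hMd⟩, hMS⟩, hmax⟩ :=
    (isCompact_setOf_posSemidef_diag_eq_one.inter_right hS).exists_isMaxOn
      ⟨N, ⟨hN.posSemidef, hd⟩, hNS⟩ continuous_id.matrix_det.continuousOn
  refine ⟨M, hM.posDef_iff_det_ne_zero.mpr ?_, hMd, hMS, fun A hA hAd hAS => hmax ⟨⟨hA, hAd⟩, hAS⟩⟩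
  exact (hN.det_pos.trans_le (hmax ⟨⟨hN.posSemidef, hd⟩, hNS⟩)).ne'

/-- The equicorrelation matrix is positive definite. -/
theorem posDef_equicorrelation {x : ℝ} (hx0 : 0 ≤ x) (hx1 : x < 1) :
    (of fun i j : V => if i = j then 1 else x).PosDef := by
  have h : (of fun i j : V => if i = j then 1 else x) =
      (1 - x) • (1 : Matrix V V ℝ) + x • vecMulVec (1 : V → ℝ) (star 1) := by
    ext i j
    by_cases hij : i = j <;> simp [hij]
  rw [h]
  exact (PosDef.one.smul (sub_pos.mpr hx1)).add_posSemidef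
    ((posSemidef_vecMulVec_self_star _).smul hx0)

/-- The symmetric perturbation of a pair of off-diagonal entries. -/
theorem Matrix.PosDef.add_symm_pair {M K : Matrix V V ℝ} (hM : M.PosDef) (hMK : M * K = 1)
    {i j : V} {t : ℝ} (ht : |t| * (K i i + K j j) ≤ 1) :
    (M + (single i j t + single j i t)).PosSemidef := by
  refine .of_dotProduct_mulVec_nonneg ?_ fun X => ?_
  · refine hM.isHermitian.add ?_
    rw [IsHermitian, conjTranspose_add, conjTranspose_single, conjTranspose_single, add_comm]
    simp
  -- Cauchy–Schwarz for the form `M`, applied to `X` and column `k` of `K`.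
  have hsq (k : V) : X k ^ 2 ≤ K k k * (X ⬝ᵥ M *ᵥ X) := by
    have h := hM.posSemidef.sq_dotProduct_mulVec_le X (K *ᵥ Pi.single k 1)
    rw [mulVec_mulVec, hMK, one_mulVec] at h
    simp only [dotProduct_single_one, mulVec_single_one, col_apply] at h
    linarith
  have hQ : 0 ≤ X ⬝ᵥ M *ᵥ X := by simpa using hM.posSemidef.dotProduct_mulVec_nonneg X
  simp only [star_trivial, add_mulVec, dotProduct_add, single_mulVec]
  have e (a b : V) : X ⬝ᵥ Function.update 0 a (t * X b) = t * (X a * X b) := by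
    rw [← Pi.single, dotProduct_single]; ring
  rw [e, e]
  have h1 : -(|t| * (X i ^ 2 + X j ^ 2)) ≤ t * (2 * (X i * X j)) := by
    have := neg_abs_le (t * (2 * (X i * X j)))
    rw [abs_mul] at this
    have h2 : |2 * (X i * X j)| ≤ X i ^ 2 + X j ^ 2 := by
      rw [abs_le]; constructor <;> nlinarith [sq_nonneg (X i + X j), sq_nonneg (X i - X j)]
    have := mul_le_mul_of_nonneg_left h2 (abs_nonneg t)
    linarith
  have h2 : |t| * (X i ^ 2 + X j ^ 2) ≤ X ⬝ᵥ M *ᵥ X := by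
    calc |t| * (X i ^ 2 + X j ^ 2)
        ≤ |t| * (K i i * (X ⬝ᵥ M *ᵥ X) + K j j * (X ⬝ᵥ M *ᵥ X)) :=
          mul_le_mul_of_nonneg_left (add_le_add (hsq i) (hsq j)) (abs_nonneg t)
      _ = (|t| * (K i i + K j j)) * (X ⬝ᵥ M *ᵥ X) := by ring
      _ ≤ X ⬝ᵥ M *ᵥ X := mul_le_of_le_one_left hQ ht
  linarith

theorem Matrix.PosDef.det_add_symm_pair {M K : Matrix V V ℝ} (hM : M.PosDef) (hMK : M * K = 1)
    (i j : V) (t : ℝ) :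
    (M + (single i j t + single j i t)).det =
      M.det * ((1 + t * K i j) ^ 2 - t ^ 2 * (K i i * K j j)) := by
  have hK : K.PosDef := (inv_eq_right_inv hMK) ▸ hM.inv
  have hs : K j i = K i j := by simpa using hK.isHermitian.apply i j
  have h := det_add_pair hMK i j 0 t t 0
  simp only [single_zero, zero_add, add_zero, zero_mul, hs] at h
  rw [h]
  ring

end

/-! ### First-order conditions and induction on edges. -/

section

variable {V : Type*} [Fintype V] [DecidableEq V] {x : ℝ}

theorem nonpos_of_forall_small_le_mul {k C ε : ℝ} (hε : 0 < ε)
    (h : ∀ t, 0 < t → t ≤ ε → k ≤ t * C) : k ≤ 0 := by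
  by_contra! hk
  have hC : 0 < C := pos_of_mul_pos_right (hk.trans_le (h ε hε le_rfl)) hε.le
  have h1 := h (min ε (k / (2 * C))) (by positivity) (min_le_left _ _)
  have h2 : min ε (k / (2 * C)) * C ≤ k / (2 * C) * C :=
    mul_le_mul_of_nonneg_right (min_le_right _ _) hC.le
  have h3 : k / (2 * C) * C = k / 2 := by field_simp
  linarith

/-- A determinant maximizer and its inverse satisfy the first-order conditions. -/
theorem exists_tightPair (G : SimpleGraph V) (hx0 : 0 ≤ x) (hx1 : x < 1) :
    ∃ M K : Matrix V V ℝ, TightPair x M K ∧ (∀ i j, G.Adj i j → M i j = x) ∧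
      ∀ i j, i ≠ j → ¬ G.Adj i j → 0 ≤ K i j := by
  let S : Set (Matrix V V ℝ) :=
    {M | (∀ i j, i ≠ j → M i j ≤ x) ∧ ∀ i j, G.Adj i j → M i j = x}
  have hS : IsClosed S := by
    have hent (i j : V) : Continuous fun M : Matrix V V ℝ => M i j :=
      continuous_id.matrix_elem i j
    simp only [S, Set.ofPred_and, Set.ofPred_forall]
    exact (isClosed_iInter fun i => isClosed_iInter fun j => isClosed_iInter fun _ =>
      isClosed_le (hent i j) continuous_const).inter
      (isClosed_iInter fun i => isClosed_iInter fun j => isClosed_iInter fun _ =>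
        isClosed_eq (hent i j) continuous_const)
  obtain ⟨M, hM, hd, ⟨hle, hadj⟩, hmax⟩ := exists_isMaxOn_det hS (posDef_equicorrelation hx0 hx1)
    (by simp) ⟨fun i j hij => by simp [hij], fun i j hij => by simp [hij.ne]⟩
  have hMK : M * M⁻¹ = 1 := mul_nonsing_inv _ hM.det_pos.ne'.isUnit
  have hsymm (i j : V) : M i j = M j i := by simpa using hM.isHermitian.apply j i
  -- Maximality against a shift by `t` at a non-edge: negative `t` is always allowed, positive `t`
  -- only where there is slack below `x`.
  have hadm {i j : V} (hij : i ≠ j) (hG : ¬ G.Adj i j) {t : ℝ}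
      (ht : |t| * (M⁻¹ i i + M⁻¹ j j) ≤ 1) (htx : M i j + t ≤ x) :
      2 * (t * M⁻¹ i j) ≤ t ^ 2 * (M⁻¹ i i * M⁻¹ j j - M⁻¹ i j ^ 2) := by
    have h := hmax _ (hM.add_symm_pair hMK ht) (fun k => by simp [single_apply, hd]; grind)
      ⟨fun a b hab => ?_, fun a b hab => ?_⟩
    · rw [hM.det_add_symm_pair hMK] at h
      have := (mul_le_iff_le_one_right hM.det_pos).mp h
      linarith
    · have h1 := hle a b hab
      have h2 := hsymm i j
      simp only [Matrix.add_apply, single_apply]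
      grind
    · have h1 := hadj a b hab
      have h2 := hab.symm
      simp only [Matrix.add_apply, single_apply]
      grind
  have hκ (i : V) : 0 < M⁻¹ i i := hM.inv.diag_pos
  refine ⟨M, M⁻¹, ⟨hM, hd, hle, hMK, fun i j hij hpos => ?_⟩, hadj, fun i j hij hG => ?_⟩
  · by_contra hne
    have hlt : M i j < x := lt_of_le_of_ne (hle i j hij) hne
    have hG : ¬ G.Adj i j := fun h => hne (hadj i j h)
    refine hpos.not_ge (nonpos_of_forall_small_le_mul
      (C := (M⁻¹ i i * M⁻¹ j j - M⁻¹ i j ^ 2) / 2)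
      (ε := min (x - M i j) (1 / (M⁻¹ i i + M⁻¹ j j)))
      (lt_min (sub_pos.mpr hlt) (by have := hκ i; have := hκ j; positivity)) fun t ht htε => ?_)
    have h1 := htε.trans (min_le_left _ _)
    have h2 := htε.trans (min_le_right _ _)
    rw [le_div_iff₀ (add_pos (hκ i) (hκ j))] at h2
    have h3 := hadm hij hG (t := t) (by rwa [abs_of_pos ht]) (by linarith)
    refine le_of_mul_le_mul_left ?_ ht
    linarith
  · refine neg_nonpos.mp (nonpos_of_forall_small_le_mul
      (C := (M⁻¹ i i * M⁻¹ j j - M⁻¹ i j ^ 2) / 2) (ε := 1 / (M⁻¹ i i + M⁻¹ j j))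
      (by have := hκ i; have := hκ j; positivity) fun t ht htε => ?_)
    rw [le_div_iff₀ (add_pos (hκ i) (hκ j))] at htε
    have h3 := hadm hij hG (t := -t) (by rwa [abs_neg, abs_of_pos ht])
      (by linarith [hle i j hij])
    refine le_of_mul_le_mul_left ?_ ht
    linarith

namespace TightPair

variable {M K : Matrix V V ℝ}

/-- Test `K` on the indicator of the non-isolated vertices; discarding the columns of isolated
vertices only lowers a row sum, their entries being nonnegative. -/
theorem exists_adj_sum_pos (h : TightPair x M K) {G : SimpleGraph V}
    (hK : ∀ i j, i ≠ j → ¬ G.Adj i j → 0 ≤ K i j) {a b : V} (hab : G.Adj a b) :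
    ∃ v u, G.Adj v u ∧ 0 < ∑ w, K v w := by
  classical
  set X : V → ℝ := fun v => if ∃ u, G.Adj v u then 1 else 0 with hX
  have hpos : 0 < X ⬝ᵥ K *ᵥ X := by
    have hne : X ≠ 0 := fun h0 => by
      have h1 := congrFun h0 a
      simp only [hX, Pi.zero_apply] at h1
      rw [if_pos ⟨b, hab⟩] at h1
      exact one_ne_zero h1
    simpa using h.posDef_right.dotProduct_mulVec_pos hne
  by_contra! hcon
  refine hpos.not_ge (Finset.sum_nonpos fun v _ => ?_)
  by_cases hv : ∃ u, G.Adj v u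
  · obtain ⟨u, hu⟩ := hv
    refine mul_nonpos_of_nonneg_of_nonpos (by simp only [hX]; split_ifs <;> simp) ?_
    refine le_trans (Finset.sum_le_sum fun w _ => ?_) (hcon v u hu)
    by_cases hw : ∃ u, G.Adj w u
    · simp [hX, hw]
    · simp only [hX, hw, if_false, mul_zero]
      exact hK v w (fun h0 => hw ⟨u, h0 ▸ hu⟩) fun h0 => hw ⟨v, h0.symm⟩
  · simp [hX, hv]

/-- An entry of the inverse at a suitable tight pair is bounded as for a `2 × 2` matrix. -/
theorem neg_right_apply_le (h : TightPair x M K) (hx0 : 0 ≤ x) (hx1 : x < 1) {v u : V}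
    (hvu : v ≠ u) (hM : M v u = x) (hv : 0 < ∑ w, K v w) :
    -K v u * (1 - x ^ 2) ≤ x := by
  have h1 := congrFun (congrFun h.mul_eq_one' v) u
  have h2 := congrFun (congrFun h.mul_eq_one' v) v
  rw [mul_apply, one_apply_ne hvu] at h1
  rw [mul_apply, one_apply_eq] at h2
  have h3 : ∑ w, K v w * (M w u - x * M w v) = -x := by
    calc ∑ w, K v w * (M w u - x * M w v)
        = ∑ w, K v w * M w u - x * ∑ w, K v w * M w v := by
          rw [Finset.mul_sum, ← Finset.sum_sub_distrib]
          exact Finset.sum_congr rfl fun w _ => by ring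
      _ = -x := by rw [h1, h2]; ring
  rw [← Finset.add_sum_erase _ _ (Finset.mem_univ u), h.diag, ← h.symm_left v u, hM] at h3
  have h4 : ∑ w ∈ Finset.univ.erase u, K v w * (M w u - x * M w v) ≤ 0 := by
    refine Finset.sum_nonpos fun w _ => ?_
    rcases eq_or_ne v w with rfl | hw
    · simp [hM, h.diag]
    · refine mul_nonpos_of_nonpos_of_nonneg (h.right_apply_nonpos hx0 hv hw) ?_
      have := h.mul_apply_le hx0 hx1 w v u
      rw [hM] at this
      linarith
  linarith

/-- The form of `K` dominates that of the inverse of the `2 × 2` block of `M` at `v`, `u`: expand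
`K` at `X - M y`, where `y` is that block inverse applied to `(X v, X u)`. -/
theorem dotProduct_mulVec_ge (h : TightPair x M K) (hx0 : 0 ≤ x) (hx1 : x < 1) {v u : V}
    (hM : M v u = x) (X : V → ℝ) :
    (X v ^ 2 + X u ^ 2 - 2 * x * (X v * X u)) / (1 - x ^ 2) ≤ X ⬝ᵥ K *ᵥ X := by
  have hq : 0 < 1 - x ^ 2 := by nlinarith
  set α := (X v - x * X u) / (1 - x ^ 2) with hα
  set β := (X u - x * X v) / (1 - x ^ 2) with hβ
  set y : V → ℝ := Pi.single v α + Pi.single u β with hy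
  have hpos := h.posDef_right.posSemidef.dotProduct_mulVec_nonneg (X - M *ᵥ y)
  have hMt : Mᵀ = M := h.posDef.isHermitian
  have hKt : Kᵀ = K := h.posDef_right.isHermitian
  have e1 : (M *ᵥ y) ⬝ᵥ K *ᵥ X = y ⬝ᵥ X := by
    rw [dotProduct_mulVec, ← mulVec_transpose, hKt, mulVec_mulVec, h.mul_eq_one', one_mulVec]
  rw [star_trivial, mulVec_sub, mulVec_mulVec, h.mul_eq_one', one_mulVec, sub_dotProduct,
    dotProduct_sub, dotProduct_sub, e1, dotProduct_comm X y] at hpos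
  have e2 : y ⬝ᵥ X = α * X v + β * X u := by
    simp [hy, add_dotProduct]
  have e3 : (M *ᵥ y) ⬝ᵥ y = α ^ 2 + β ^ 2 + 2 * x * (α * β) := by
    have := h.symm_left u v
    simp [hy, mulVec_add, dotProduct_add, h.diag, this, hM]
    ring
  rw [e2, e3] at hpos
  have e4 : (X v ^ 2 + X u ^ 2 - 2 * x * (X v * X u)) / (1 - x ^ 2) =
      2 * (α * X v + β * X u) - (α ^ 2 + β ^ 2 + 2 * x * (α * β)) := by
    rw [hα, hβ]
    field_simp
    ring
  rw [e4]
  linarith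

/-- The perturbation of the inverse that cancels the off-diagonal entries at `v`, `u` when
`J = -K v u`. -/
theorem posSemidef_add_pair (h : TightPair x M K) (hx0 : 0 ≤ x) (hx1 : x < 1) {v u : V}
    (hM : M v u = x) {J : ℝ} (hJ0 : 0 ≤ J) (hJ : J * (1 - x ^ 2) ≤ x) :
    (K + (single v v (-(J * x)) + single v u J +
      (single u v J + single u u (-(J * x))))).PosSemidef := by
  have hq : 0 < 1 - x ^ 2 := by nlinarith
  refine .of_dotProduct_mulVec_nonneg ?_ fun X => ?_
  · refine h.posDef_right.isHermitian.add ?_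
    simp only [IsHermitian, conjTranspose_add, conjTranspose_single, star_trivial]
    abel
  have e (a b : V) (t : ℝ) : X ⬝ᵥ Function.update 0 a (t * X b) = t * (X a * X b) := by
    rw [← Pi.single, dotProduct_single]; ring
  simp only [star_trivial, add_mulVec, dotProduct_add, single_mulVec, e]
  have h1 := h.dotProduct_mulVec_ge hx0 hx1 hM X
  have h2 : J * (x * (X v ^ 2 + X u ^ 2) - 2 * (X v * X u)) ≤
      (X v ^ 2 + X u ^ 2 - 2 * x * (X v * X u)) / (1 - x ^ 2) := by
    have hA : 0 ≤ X v ^ 2 + X u ^ 2 - 2 * x * (X v * X u) := by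
      nlinarith [sq_nonneg (X v - X u), sq_nonneg (X v + X u)]
    rw [le_div_iff₀ hq]
    rcases le_total (x * (X v ^ 2 + X u ^ 2) - 2 * (X v * X u)) 0 with hneg | hnonneg
    · have := mul_nonpos_of_nonneg_of_nonpos (mul_nonneg hJ0 hq.le) hneg
      linarith
    · have := mul_le_mul_of_nonneg_right hJ hnonneg
      have : 0 ≤ (1 - x ^ 2) * (X v ^ 2 + X u ^ 2) := by positivity
      linarith
  linarith

end TightPair

theorem exists_posDef_det_ge (hx0 : 0 ≤ x) (hx1 : x < 1) (n : ℕ) (G : SimpleGraph V)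
    (hn : G.edgeSet.ncard = n) :
    ∃ M : Matrix V V ℝ, M.PosDef ∧ (∀ i, M i i = 1) ∧ (∀ i j, i ≠ j → M i j ≤ x) ∧
      (∀ i j, G.Adj i j → M i j = x) ∧ (1 - x ^ 2) ^ n ≤ M.det := by
  classical
  induction n generalizing G with
  | zero =>
    have hE : G.edgeSet = ∅ := (Set.ncard_eq_zero (Set.toFinite _)).mp hn
    refine ⟨1, .one, by simp, fun i j hij => by simpa [hij] using hx0, fun i j hij => ?_, by simp⟩
    have : s(i, j) ∈ G.edgeSet := hij
    simp [hE] at this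
  | succ n ih =>
    obtain ⟨M, K, h, hadj, hK⟩ := exists_tightPair G hx0 hx1
    obtain ⟨e, he⟩ := Set.nonempty_of_ncard_ne_zero (s := G.edgeSet) (by lia)
    induction e with | _ a b
    obtain ⟨v, u, hvu, hv⟩ := h.exists_adj_sum_pos hK he
    have hJ0 : 0 ≤ -K v u := neg_nonneg.mpr (h.right_apply_nonpos hx0 hv hvu.ne)
    have hJ := h.neg_right_apply_le hx0 hx1 hvu.ne (hadj v u hvu) hv
    have hps := h.posSemidef_add_pair hx0 hx1 (hadj v u hvu) hJ0 hJ
    obtain ⟨N, hN, hNd, hNle, hNadj, hNdet⟩ := ih (G.deleteEdges {s(v, u)}) (by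
      rw [SimpleGraph.edgeSet_deleteEdges, Set.ncard_sdiff_singleton_of_mem (G.mem_edgeSet.mpr hvu), hn,
        Nat.add_sub_cancel])
    refine ⟨M, h.posDef, h.diag, h.le, hadj, ?_⟩
    set J := -K v u with hJdef
    have hdet := det_add_pair h.mul_eq_one' v u (-(J * x)) J J (-(J * x))
    set L := K + (single v v (-(J * x)) + single v u J + (single u v J + single u u (-(J * x))))
      with hL
    have hLM : (L * M).trace = Fintype.card V := by
      rw [hL, Matrix.add_mul, h.mul_eq_one', trace_add, trace_one]
      have := h.symm_left u v
      simp [Matrix.add_mul, trace_add, trace_single_mul, h.diag, this, hadj v u hvu]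
    -- Entrywise: `L` vanishes at `vu`, `M` and `N` agree on the diagonal and at the remaining
    -- edges, and where `K` is positive at a non-edge, `M` equals `x`, which bounds `N`.
    have htr : (L * N).trace ≤ Fintype.card V := by
      rw [← hLM]
      simp only [trace, diag_apply, mul_apply]
      refine Finset.sum_le_sum fun i _ => Finset.sum_le_sum fun j _ => ?_
      rcases eq_or_ne i j with rfl | hij
      · rw [hNd, h.diag]
      have hLij : L i j = K i j + (if s(i, j) = s(v, u) then J else 0) := by
        have hne := hvu.ne
        simp only [hL, Matrix.add_apply, single_apply, Sym2.eq_iff]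
        grind
      by_cases hs : s(i, j) = s(v, u)
      · have hKij : K i j = -J := by
          have := h.symm_right u v
          rw [Sym2.eq_iff] at hs
          grind
        rw [hLij, hKij, if_pos hs]
        simp
      rw [hLij, if_neg hs, add_zero]
      by_cases hG : G.Adj j i
      · rw [hadj j i hG, hNadj j i (by
          rw [SimpleGraph.deleteEdges_adj]
          exact ⟨hG, fun h0 => hs (Sym2.eq_swap.trans h0)⟩)]
      · rcases (hK i j hij fun h0 => hG h0.symm).eq_or_lt with h0 | h0
        · simp [← h0]
        · rw [h.symm_left j i, h.tight i j hij h0]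
          exact mul_le_mul_of_nonneg_left (hNle j i hij.symm) h0.le
    have hAG := hps.det_mul_det_le_one hN.posSemidef htr
    have hdKM : K.det * M.det = 1 := by rw [← det_mul, h.mul_eq_one', det_one]
    rw [hdet, h.diag, h.diag, h.symm_left u v, hadj v u hvu] at hAG
    have hJ2 : (J * (1 - x ^ 2)) ^ 2 ≤ x ^ 2 := by
      have : 0 < 1 - x ^ 2 := by nlinarith
      exact pow_le_pow_left₀ (by positivity) hJ 2
    have hq : 0 < 1 - x ^ 2 := by nlinarith
    calc (1 - x ^ 2) ^ (n + 1) = (1 - x ^ 2) ^ n * (1 - x ^ 2) := pow_succ _ _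
      _ ≤ N.det * (1 - (J * (1 - x ^ 2)) ^ 2) :=
          mul_le_mul hNdet (by linarith) hq.le hN.det_pos.le
      _ = M.det * (K.det * (1 - (J * (1 - x ^ 2)) ^ 2) * N.det) := by
          linear_combination -(N.det * (1 - (J * (1 - x ^ 2)) ^ 2)) * hdKM
      _ ≤ M.det * 1 := by
          refine mul_le_mul_of_nonneg_left (le_of_eq_of_le ?_ hAG) h.posDef.det_pos.le
          ring
      _ = M.det := mul_one _

end

theorem theorem1 {V : Type*} [Fintype V] [DecidableEq V] (G : SimpleGraph V) [DecidableRel G.Adj]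
    (x : ℝ) (hx0 : 0 ≤ x) (hx1 : x < 1) :
    IsGreatest (Matrix.det '' admissible G x) (tau G x) ∧
      (1 - x ^ 2) ^ G.edgeFinset.card ≤ tau G x := by
  have hS : IsClosed {M : Matrix V V ℝ | ∀ i j, G.Adj i j → M i j = x} := by
    simp only [Set.ofPred_forall]
    exact isClosed_iInter fun i => isClosed_iInter fun j => isClosed_iInter fun _ =>
      isClosed_eq (continuous_id.matrix_elem i j) continuous_const
  obtain ⟨M, hM, hd, hadj, hmax⟩ := exists_isMaxOn_det hS (posDef_equicorrelation hx0 hx1)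
    (by simp) fun i j hij => by simp [hij.ne]
  have hgreatest : IsGreatest (Matrix.det '' admissible G x) M.det := by
    refine ⟨⟨M, ⟨hM, hd, hadj⟩, rfl⟩, ?_⟩
    rintro _ ⟨A, ⟨hA, hAd, hAadj⟩, rfl⟩
    exact hmax A hA.posSemidef hAd hAadj
  have htau : tau G x = M.det := hgreatest.csSup_eq
  obtain ⟨N, hN, hNd, -, hNadj, hdet⟩ := exists_posDef_det_ge hx0 hx1 _ G rfl
  rw [← SimpleGraph.coe_edgeFinset, Set.ncard_coe_finset] at hdet
  rw [htau]
  exact ⟨hgreatest, hdet.trans (hgreatest.2 ⟨N, ⟨hN, hNd, hNadj⟩, rfl⟩)⟩
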